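/- Let $n\ge 1$, $k\ge 1$, let $\|\cdot\|$ be a norm on $\mathbb{R}^n$ (for instance a $p$-norm, $1\le p\le\infty$), and write $\|\cdot\|$ also for the induced matrix norm on $\mathbb{R}^{n\times n}$. Minima, maxima and inequalities of vectors are componentwise, and $v_+=\max\{0,v\}$. For $A_1,\dots,A_k\in\mathbb{R}^{n\times n}$ and $q=(q_1,\dots,q_k)$ with $q_i\in\mathbb{R}^n$, the problem $\mathrm{VLCP}(A,q)$ is to find $x\in\mathbb{R}^n$ with $$\min\{x,\;A_1x+q_1,\;\dots,\;A_kx+q_k\}=0 .$$ The block matrix $(I,A_1,\dots,A_k)$ has the row $\mathcal W$-property if $$\min(x,A_1x,\dots,A_kx)\le 0\le \max(x,A_1x,\dots,A_kx)\ \Longrightarrow\ x=0 .$$ Let $\mathcal D$ be the set of all tuples $(D_0,\dots,D_k)$ of diagonal $n\times n$ matrices with diagonal entries in $[0,1]$ and $\sum_{i=0}^kD_i=I$. **Theorem.** Let $(I,M_1,\dots,M_k)$ have the row $\mathcal W$-property. Then $D_0+\sum_{l=1}^kD_lM_l$ is nonsingular for every $(D_0,\dots,D_k)\in\mathcal D$,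 and the maxima $$\tilde\alpha_i=\max_{(D_0,\dots,D_k)\in\mathcal D}\Big\|\Big(D_0+\sum_{l=1}^kD_lM_l\Big)^{-1}D_i\Big\|,\qquad i=1,\dots,k,$$ exist. Moreover: (i) For all $q=(q_1,\dots,q_k)$ and $\tilde q=(\tilde q_1,\dots,\tilde q_k)$ with $q_i,\tilde q_i\in\mathbb{R}^n$, the problems $\mathrm{VLCP}(M,q)$ and $\mathrm{VLCP}(M,\tilde q)$ have unique solutions $x^*$ and $y^*$, respectively, and $$\|x^*-y^*\|\le\sum_{i=1}^k\tilde\alpha_i\,\|\tilde q_i-q_i\| .$$ (ii) Let $\eta<1$, $\tilde\tau_i=\tilde\alpha_i/(1-\eta)$, and let $\tilde{\mathfrak M}$ be the set of all block matrices $(I,A_1,\dots,A_k)$ with $\sum_{i=1}^k\tilde\alpha_i\|A_i-M_i\|\le\eta$. Every element of $\tilde{\mathfrak M}$ has the row $\mathcal W$-property. For all $(I,A_1,\dots,A_k),(I,B_1,\dots,B_k)\in\tilde{\mathfrak M}$ and all $\hat q=(\hat q_1,\dots,\hat q_k)$, $\hat p=(\hat p_1,\dots,\hat p_k)$ with $\hat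 q_i,\hat p_i\in\mathbb{R}^n$, the problems $\mathrm{VLCP}(A,\hat q)$ and $\mathrm{VLCP}(B,\hat p)$ have unique solutions $x^*$ and $y^*$, respectively, and $$\|x^*-y^*\|\le\Big(\sum_{i=1}^k\tilde\tau_i\|A_i-B_i\|\Big)\Big(\sum_{i=1}^k\tilde\tau_i\|(-\hat p_i)_+\|\Big)+\sum_{i=1}^k\tilde\tau_i\|\hat q_i-\hat p_i\| .$$ -/

import Mathlib

/-- Componentwise minimum of finitely many vectors `v 0, …, v k` of `ℝⁿ`. -/
noncomputable def blockMin {n k : ℕ} (v : Fin (k + 1) → Fin n → ℝ) : Fin n → ℝ :=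
  fun j => Finset.univ.inf' Finset.univ_nonempty (fun i => v i j)

/-- Componentwise maximum of finitely many vectors `v 0, …, v k` of `ℝⁿ`. -/
noncomputable def blockMax {n k : ℕ} (v : Fin (k + 1) → Fin n → ℝ) : Fin n → ℝ :=
  fun j => Finset.univ.sup' Finset.univ_nonempty (fun i => v i j)

/-- The row `W`-property of a block matrix `(M 0, …, M k)`. -/
def RowWProperty {n k : ℕ} (M : Fin (k + 1) → Matrix (Fin n) (Fin n) ℝ) : Prop :=
  ∀ x : Fin n → ℝ,
    blockMin (fun i => (M i).mulVec x) ≤ 0 → 0 ≤ blockMax (fun i => (M i).mulVec x) → x = 0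

/-- `x` solves the extended vertical linear complementarity problem
`min {M 0 x + q 0, …, M k x + q k} = 0`. -/
def IsEVLCPSolution {n k : ℕ} (M : Fin (k + 1) → Matrix (Fin n) (Fin n) ℝ)
    (q : Fin (k + 1) → Fin n → ℝ) (x : Fin n → ℝ) : Prop :=
  blockMin (fun i => (M i).mulVec x + q i) = 0

/-- The block matrix `(I, M₁, …, M_k)`; the matrix `M_{i+1}` is `M i` for `i : Fin k`. -/
def vlcpBlock {n k : ℕ} (M : Fin k → Matrix (Fin n) (Fin n) ℝ) :
    Fin (k + 1) → Matrix (Fin n) (Fin n) ℝ :=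
  Matrix.vecCons 1 M

/-- `x` solves the vertical linear complementarity problem
`min {x, M₁ x + q₁, …, M_k x + q_k} = 0`, which is the extended problem with data
`(I, M₁, …, M_k)` and `(0, q₁, …, q_k)`. -/
def IsVLCPSolution {n k : ℕ} (M : Fin k → Matrix (Fin n) (Fin n) ℝ)
    (q : Fin k → Fin n → ℝ) (x : Fin n → ℝ) : Prop :=
  IsEVLCPSolution (vlcpBlock M) (Matrix.vecCons 0 q) x

/-- The tuples `(D 0, …, D k)` of diagonal matrices with diagonal entries in `[0, 1]`
and sum `I`. -/
def diagTuples (n k : ℕ) : Set (Fin (k + 1) → Matrix (Fin n) (Fin n) ℝ) :=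
  {D | (∀ i, ∃ d : Fin n → ℝ, (∀ j, d j ∈ Set.Icc (0 : ℝ) 1) ∧ D i = Matrix.diagonal d) ∧
    ∑ i, D i = 1}

/-- The matrix `D₀ + ∑_{i=1}^k D_i M_i`. -/
def vlcpSum {n k : ℕ} (M : Fin k → Matrix (Fin n) (Fin n) ℝ)
    (D : Fin (k + 1) → Matrix (Fin n) (Fin n) ℝ) : Matrix (Fin n) (Fin n) ℝ :=
  D 0 + ∑ i : Fin k, D i.succ * M i

/-- The matrix norm induced by a vector norm `N`: the least `c ≥ 0` with
`N (A x) ≤ c * N x` for all `x`. -/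
noncomputable def inducedNorm {n : ℕ} (N : Seminorm ℝ (Fin n → ℝ))
    (A : Matrix (Fin n) (Fin n) ℝ) : ℝ :=
  sInf {c : ℝ | 0 ≤ c ∧ ∀ x, N (A.mulVec x) ≤ c * N x}

/-- The values `‖(D₀ + ∑_{l=1}^k D_l M_l)⁻¹ D_i‖` over all admissible tuples `D`; the index
`i : Fin k` stands for the block number `i + 1`. -/
def alphaValues {n k : ℕ} (N : Seminorm ℝ (Fin n → ℝ))
    (M : Fin k → Matrix (Fin n) (Fin n) ℝ) (i : Fin k) : Set ℝ :=
  (fun D => inducedNorm N ((vlcpSum M D)⁻¹ * D i.succ)) '' diagTuples n k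

/-- The constant `α̃_i(M)`, the largest element of `alphaValues N M i`. -/
noncomputable def alphaTilde {n k : ℕ} (N : Seminorm ℝ (Fin n → ℝ))
    (M : Fin k → Matrix (Fin n) (Fin n) ℝ) (i : Fin k) : ℝ :=
  sSup (alphaValues N M i)

/-- The constant `τ̃_i(M) = α̃_i(M) / (1 - η)`. -/
noncomputable def tauTilde {n k : ℕ} (N : Seminorm ℝ (Fin n → ℝ))
    (M : Fin k → Matrix (Fin n) (Fin n) ℝ) (η : ℝ) (i : Fin k) : ℝ :=
  1 / (1 - η) * alphaTilde N M i

/-- The neighbourhood of all `(A₁, …, A_k)` with `∑_{i=1}^k α̃_i(M) ‖A_i - M_i‖ ≤ η`. -/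
def vlcpNhd {n k : ℕ} (N : Seminorm ℝ (Fin n → ℝ))
    (M : Fin k → Matrix (Fin n) (Fin n) ℝ) (η : ℝ) : Set (Fin k → Matrix (Fin n) (Fin n) ℝ) :=
  {A | ∑ i, alphaTilde N M i * inducedNorm N (A i - M i) ≤ η}

/-! For solutions `x` and `y` of two problems, the residual differences have in each row a
nonpositive and a nonnegative entry, so convex weights in each row make them cancel. These weights
form a tuple `D`, and the two problems become one linear equation for `x - y` with matrix `vlcpSum A
D`. The row W-property amounts to invertibility of `vlcpSum M D` for all `D`. Compactness of
`diagTuples` then gives the maxima, and applying the inverse gives the bound at `M`. For `A` near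
`M`, the term with `A i - M i` goes to the right-hand side and is absorbed, as `η < 1`
(`seminorm_le_sum_tauTilde`). Uniqueness is the W-property applied to a difference of solutions;
existence is a combinatorial induction (`RowWProperty.exists_restricted_solution`). -/

/-- Zero lies on the segment from `d a` to `d b`, so weights supported on `a` and `b` suffice; `a =
b` is allowed. -/
theorem exists_weights_sum_eq_zero {ι : Type*} [Fintype ι] [DecidableEq ι] (d : ι → ℝ) {a b : ι}
    (ha : d a ≤ 0) (hb : 0 ≤ d b) :
    ∃ w : ι → ℝ, (∀ i, 0 ≤ w i) ∧ ∑ i, w i = 1 ∧ ∑ i, w i * d i = 0 := by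
  have h0 : (0 : ℝ) ∈ segment ℝ (d a) (d b) := by
    rw [segment_eq_Icc (ha.trans hb)]
    exact ⟨ha, hb⟩
  obtain ⟨s, t, hs, ht, hst, h⟩ := h0
  refine ⟨Pi.single a s + Pi.single b t, fun i => ?_, ?_, ?_⟩
  · have h1 : 0 ≤ (Pi.single a s : ι → ℝ) := Pi.single_nonneg.2 hs
    have h2 : 0 ≤ (Pi.single b t : ι → ℝ) := Pi.single_nonneg.2 ht
    exact add_nonneg (h1 i) (h2 i)
  · simp [Finset.sum_add_distrib, hst]
  · simpa [add_mul, Finset.sum_add_distrib, Pi.single_apply, ite_mul] using h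

/-! ### Existence and uniqueness of solutions. -/

theorem rowWProperty_iff {n k : ℕ} {M : Fin (k + 1) → Matrix (Fin n) (Fin n) ℝ} :
    RowWProperty M ↔ ∀ x : Fin n → ℝ, (∀ j, ∃ i, (M i).mulVec x j ≤ 0) →
      (∀ j, ∃ i, 0 ≤ (M i).mulVec x j) → x = 0 := by
  simp [RowWProperty, blockMin, blockMax, Pi.le_def]

theorem isEVLCPSolution_iff {n k : ℕ} {M : Fin (k + 1) → Matrix (Fin n) (Fin n) ℝ}
    {q : Fin (k + 1) → Fin n → ℝ} {x : Fin n → ℝ} :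
    IsEVLCPSolution M q x ↔ ∀ j, (∀ i, 0 ≤ ((M i).mulVec x + q i) j) ∧
      ∃ i, ((M i).mulVec x + q i) j ≤ 0 := by
  simp only [IsEVLCPSolution, blockMin, funext_iff, le_antisymm_iff (b := (0 : Fin n → ℝ) _)]
  refine forall_congr' fun j => ?_
  rw [and_comm]
  simp [Finset.le_inf'_iff, Finset.inf'_le_iff]

/-- Existence for the system in which row `j` takes its minimum over the index set `S j` only. -/
theorem RowWProperty.exists_restricted_solution {n k : ℕ}
    {M : Fin (k + 1) → Matrix (Fin n) (Fin n) ℝ} (hM : RowWProperty M)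
    (q : Fin (k + 1) → Fin n → ℝ) (S : Fin n → Finset (Fin (k + 1))) (hS : ∀ j, (S j).Nonempty) :
    ∃ x : Fin n → ℝ, ∀ j, (∀ i ∈ S j, 0 ≤ ((M i).mulVec x + q i) j) ∧
      ∃ i ∈ S j, ((M i).mulVec x + q i) j ≤ 0 := by
  rw [rowWProperty_iff] at hM
  induction hm : ∑ j, (S j).card using Nat.strong_induction_on generalizing S with
  | _ m ih =>
  by_cases h1 : ∀ j, ∃ a, S j = {a}
  · choose σ hσ using h1
    -- With one index per row the system is linear and square; a kernel vector of `R` meets both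
    -- sign conditions of the W-property.
    let R : Matrix (Fin n) (Fin n) ℝ := Matrix.of fun j => M (σ j) j
    have hR : ∀ x j, R.mulVec x j = (M (σ j)).mulVec x j := fun x j => rfl
    have hinj : Function.Injective R.mulVecLin := by
      rw [← LinearMap.ker_eq_bot, LinearMap.ker_eq_bot']
      intro x hx
      have hx' : ∀ j, (M (σ j)).mulVec x j = 0 := fun j => by
        rw [← hR]; exact congrFun hx j
      exact hM x (fun j => ⟨σ j, (hx' j).le⟩) fun j => ⟨σ j, (hx' j).ge⟩
    obtain ⟨x, hx⟩ := (LinearMap.injective_iff_surjective.1 hinj) fun j => - q (σ j) j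
    have hx' : ∀ j, ((M (σ j)).mulVec x + q (σ j)) j = 0 := fun j => by
      rw [Pi.add_apply, ← hR, show R.mulVec x j = _ from congrFun hx j]; simp
    exact ⟨x, fun j => by simp [hσ, -Pi.add_apply, hx']⟩
  · push Not at h1
    obtain ⟨j₀, hj₀⟩ := h1
    obtain ⟨a, ha⟩ := hS j₀
    have hT : ((S j₀).erase a).Nonempty := by
      rw [Finset.nonempty_iff_ne_empty]
      intro h
      rcases Finset.erase_eq_empty_iff _ _ |>.1 h with h | h
      · simp [h] at ha
      · exact hj₀ a h
    have hcard : 0 < ((S j₀).erase a).card := hT.card_pos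
    have herase := Finset.card_erase_add_one ha
    -- Row `j₀` has at least two indices. It is split into `{a}` and the rest; the induction
    -- hypothesis solves both smaller systems.
    have key : ∀ T : Finset (Fin (k + 1)), T.Nonempty → T.card < (S j₀).card →
        ∃ x : Fin n → ℝ, ∀ j, (∀ i ∈ Function.update S j₀ T j, 0 ≤ ((M i).mulVec x + q i) j) ∧
          ∃ i ∈ Function.update S j₀ T j, ((M i).mulVec x + q i) j ≤ 0 := by
      intro T hTn hlt
      refine ih (∑ j, (Function.update S j₀ T j).card) ?_ _ ?_ rfl
      · rw [← hm]
        refine Finset.sum_lt_sum (fun j _ => ?_) ⟨j₀, Finset.mem_univ _, by simpa using hlt⟩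
        by_cases h : j = j₀
        · subst h; simpa using hlt.le
        · simp [h]
      · intro j
        by_cases h : j = j₀
        · subst h; simpa using hTn
        · simpa [h] using hS j
    obtain ⟨x, hx⟩ := key _ hT (by omega)
    obtain ⟨y, hy⟩ := key {a} (by simp) (by simp; omega)
    have hx₀ := hx j₀
    have hy₀ := hy j₀
    simp only [Function.update_self, Finset.mem_singleton, forall_eq, exists_eq_left] at hx₀ hy₀
    by_cases hax : 0 ≤ ((M a).mulVec x + q a) j₀
    · refine ⟨x, fun j => ?_⟩
      by_cases h : j = j₀
      · subst h
        obtain ⟨i, hi, hi'⟩ := hx₀.2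
        refine ⟨fun i hi => ?_, i, Finset.mem_of_mem_erase hi, hi'⟩
        by_cases hia : i = a
        · rwa [hia]
        · exact hx₀.1 i (Finset.mem_erase.2 ⟨hia, hi⟩)
      · simpa only [Function.update_of_ne h] using hx j
    by_cases hby : ∀ i ∈ (S j₀).erase a, 0 ≤ ((M i).mulVec y + q i) j₀
    · refine ⟨y, fun j => ?_⟩
      by_cases h : j = j₀
      · subst h
        refine ⟨fun i hi => ?_, a, ha, hy₀.2⟩
        by_cases hia : i = a
        · rw [hia]; exact hy₀.1
        · exact hby i (Finset.mem_erase.2 ⟨hia, hi⟩)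
      · simpa only [Function.update_of_ne h] using hy j
    -- If neither `x` nor `y` solves the full system, then in row `j₀` the index `a` makes `x - y`
    -- negative and `b` makes it positive. The other rows share their index sets, so the W-property
    -- forces `x = y`, which is absurd.
    exfalso
    push Not at hax hby
    obtain ⟨b, hb, hby⟩ := hby
    have hbx := hx₀.1 b hb
    simp only [Pi.add_apply] at hax hby hbx hx hy hy₀
    have hz : x - y = 0 := by
      refine hM _ (fun j => ?_) fun j => ?_
      · by_cases h : j = j₀
        · subst h
          exact ⟨a, by rw [Matrix.mulVec_sub, Pi.sub_apply]; linarith [hy₀.1]⟩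
        · obtain ⟨i, hi, hi'⟩ := (hx j).2
          have := (hy j).1 i (by rwa [Function.update_of_ne h] at hi ⊢)
          exact ⟨i, by rw [Matrix.mulVec_sub, Pi.sub_apply]; linarith⟩
      · by_cases h : j = j₀
        · subst h
          exact ⟨b, by rw [Matrix.mulVec_sub, Pi.sub_apply]; linarith⟩
        · obtain ⟨i, hi, hi'⟩ := (hy j).2
          have := (hx j).1 i (by rwa [Function.update_of_ne h] at hi ⊢)
          exact ⟨i, by rw [Matrix.mulVec_sub, Pi.sub_apply]; linarith⟩
    rw [sub_eq_zero] at hz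
    subst hz
    linarith [hy₀.1]

theorem RowWProperty.existsUnique_solution {n k : ℕ}
    {M : Fin (k + 1) → Matrix (Fin n) (Fin n) ℝ} (hM : RowWProperty M)
    (q : Fin (k + 1) → Fin n → ℝ) : ∃! x, IsEVLCPSolution M q x := by
  obtain ⟨x, hx⟩ := hM.exists_restricted_solution q (fun _ => Finset.univ) (fun _ => by simp)
  refine ⟨x, isEVLCPSolution_iff.2 (by simpa using hx), fun y hy => ?_⟩
  replace hy := isEVLCPSolution_iff.1 hy
  simp only [Pi.add_apply, Finset.mem_univ, true_and, forall_const] at hx hy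
  rw [← sub_eq_zero]
  refine rowWProperty_iff.1 hM _ (fun j => ?_) fun j => ?_
  · obtain ⟨i, hi⟩ := (hy j).2
    exact ⟨i, by rw [Matrix.mulVec_sub, Pi.sub_apply]; linarith [(hx j).1 i]⟩
  · obtain ⟨i, hi⟩ := (hx j).2
    exact ⟨i, by rw [Matrix.mulVec_sub, Pi.sub_apply]; linarith [(hy j).1 i]⟩

/-! ### The W-property as nonsingularity over all diagonal tuples. -/

/-- If in every row `u` has a nonpositive and a nonnegative entry, then some admissible tuple of
diagonal matrices annihilates it. -/
theorem exists_diagTuples_sum_mulVec_eq_zero {n k : ℕ} (u : Fin (k + 1) → Fin n → ℝ)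
    (h₁ : ∀ j, ∃ i, u i j ≤ 0) (h₂ : ∀ j, ∃ i, 0 ≤ u i j) :
    ∃ D ∈ diagTuples n k, ∑ i, (D i).mulVec (u i) = 0 := by
  have h : ∀ j, ∃ w : Fin (k + 1) → ℝ, (∀ i, 0 ≤ w i) ∧ ∑ i, w i = 1 ∧ ∑ i, w i * u i j = 0 := by
    intro j
    obtain ⟨a, ha⟩ := h₁ j
    obtain ⟨b, hb⟩ := h₂ j
    exact exists_weights_sum_eq_zero (fun i => u i j) ha hb
  choose w hw0 hw1 hw using h
  refine ⟨fun i => Matrix.diagonal fun j => w j i, ⟨fun i => ⟨_, fun j => ⟨hw0 j i, ?_⟩, rfl⟩, ?_⟩,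
    ?_⟩
  · rw [← hw1 j]
    exact Finset.single_le_sum (fun i _ => hw0 j i) (Finset.mem_univ i)
  · ext a b
    rw [Matrix.sum_apply]
    by_cases hab : a = b
    · subst hab; simp [hw1]
    · simp [hab]
  · ext j
    simpa [Matrix.mulVec_diagonal, Finset.sum_apply] using hw j

theorem vlcpSum_mulVec {n k : ℕ} (M : Fin k → Matrix (Fin n) (Fin n) ℝ)
    (D : Fin (k + 1) → Matrix (Fin n) (Fin n) ℝ) (x : Fin n → ℝ) :
    (vlcpSum M D).mulVec x =
      (D 0).mulVec x + ∑ i : Fin k, (D i.succ).mulVec ((M i).mulVec x) := by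
  simp [vlcpSum, Matrix.add_mulVec, Matrix.sum_mulVec]

theorem isUnit_of_mulVec_eq_zero {n : ℕ} {A : Matrix (Fin n) (Fin n) ℝ}
    (h : ∀ x, A.mulVec x = 0 → x = 0) : IsUnit A := by
  rw [← Matrix.mulVec_injective_iff_isUnit]
  intro x y hxy
  rw [← sub_eq_zero]
  exact h _ (by rw [Matrix.mulVec_sub, hxy, sub_self])

/-- For a kernel vector, a convex combination of the block entries vanishes in each row, so these
entries are neither all positive nor all negative. -/
theorem RowWProperty.isUnit_vlcpSum {n k : ℕ} {M : Fin k → Matrix (Fin n) (Fin n) ℝ}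
    (hM : RowWProperty (vlcpBlock M)) {D : Fin (k + 1) → Matrix (Fin n) (Fin n) ℝ}
    (hD : D ∈ diagTuples n k) : IsUnit (vlcpSum M D) := by
  obtain ⟨hd, hsum⟩ := hD
  choose d hd hDd using hd
  have hsum' : ∀ j, ∑ i, d i j = 1 := fun j => by
    have := congrFun (congrFun hsum j) j
    simpa [Matrix.sum_apply, hDd] using this
  refine isUnit_of_mulVec_eq_zero fun x hx => ?_
  have hrow : ∀ j, ∑ i, d i j * (vlcpBlock M i).mulVec x j = 0 := fun j => by
    have := congrFun hx j
    rw [vlcpSum_mulVec] at this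
    simpa [-Matrix.mulVec_mulVec, hDd, Matrix.mulVec_diagonal, Finset.sum_apply, Fin.sum_univ_succ,
      vlcpBlock] using this
  refine rowWProperty_iff.1 hM x (fun j => ?_) fun j => ?_
  · by_contra! h
    have hz := (Finset.sum_eq_zero_iff_of_nonneg
      fun i _ => mul_nonneg (hd i j).1 (h i).le).1 (hrow j)
    have hd0 : ∀ i, d i j = 0 := fun i =>
      (mul_eq_zero.1 (hz i (Finset.mem_univ i))).resolve_right (h i).ne'
    simpa [hd0] using hsum' j
  · by_contra! h
    have hz := (Finset.sum_eq_zero_iff_of_nonpos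
      fun i _ => mul_nonpos_of_nonneg_of_nonpos (hd i j).1 (h i).le).1 (hrow j)
    have hd0 : ∀ i, d i j = 0 := fun i =>
      (mul_eq_zero.1 (hz i (Finset.mem_univ i))).resolve_right (h i).ne
    simpa [hd0] using hsum' j

theorem rowWProperty_of_isUnit_vlcpSum {n k : ℕ} {M : Fin k → Matrix (Fin n) (Fin n) ℝ}
    (hM : ∀ D ∈ diagTuples n k, IsUnit (vlcpSum M D)) : RowWProperty (vlcpBlock M) := by
  rw [rowWProperty_iff]
  intro x h₁ h₂
  obtain ⟨D, hD, h⟩ := exists_diagTuples_sum_mulVec_eq_zero _ h₁ h₂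
  apply Matrix.mulVec_injective_iff_isUnit.2 (hM D hD)
  rw [Matrix.mulVec_zero, vlcpSum_mulVec]
  simpa [Fin.sum_univ_succ, vlcpBlock] using h

theorem isCompact_diagTuples (n k : ℕ) : IsCompact (diagTuples n k) := by
  have hK : IsCompact (Set.univ.pi fun _ : Fin (k + 1) =>
      Matrix.diagonal '' (Set.univ.pi fun _ : Fin n => Set.Icc (0 : ℝ) 1)) := by
    refine isCompact_univ_pi fun _ => (isCompact_univ_pi fun _ => isCompact_Icc).image ?_
    exact Continuous.matrix_diagonal continuous_id
  have hC : IsClosed {D : Fin (k + 1) → Matrix (Fin n) (Fin n) ℝ | ∑ i, D i = 1} :=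
    isClosed_eq (by fun_prop) continuous_const
  convert hK.inter_right hC using 1
  ext D
  simp [diagTuples, Set.mem_pi, forall_and, Pi.le_def, eq_comm]

theorem diagTuples_nonempty (n k : ℕ) : (diagTuples n k).Nonempty := by
  obtain ⟨D, hD, -⟩ := exists_diagTuples_sum_mulVec_eq_zero (n := n) (k := k) 0
    (fun _ => ⟨0, le_rfl⟩) fun _ => ⟨0, le_rfl⟩
  exact ⟨D, hD⟩

/-! ### Norms in finite dimension and the induced matrix norm. -/

theorem Seminorm.continuous_of_finiteDimensional {E : Type*} [NormedAddCommGroup E]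
    [NormedSpace ℝ E] [FiniteDimensional ℝ E] (p : Seminorm ℝ E) : Continuous p :=
  p.convexOn.locallyLipschitz.continuous

theorem Seminorm.exists_norm_le_mul {E : Type*} [NormedAddCommGroup E]
    [NormedSpace ℝ E] [FiniteDimensional ℝ E] (p : Seminorm ℝ E) (hp : ∀ x, p x = 0 → x = 0) :
    ∃ C, 0 ≤ C ∧ ∀ x, ‖x‖ ≤ C * p x := by
  have : ProperSpace E := FiniteDimensional.proper_real E
  have hpos : ∀ x ∈ Metric.sphere (0 : E) 1, 0 < p x := fun x hx =>
    lt_of_le_of_ne (apply_nonneg p x) fun h => by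
      rw [hp x h.symm] at hx
      simp at hx
  -- This form also covers the empty sphere of a trivial space.
  obtain ⟨c, hc, h⟩ := (isCompact_sphere (0 : E) 1).exists_forall_le' (a := 0)
    p.continuous_of_finiteDimensional.continuousOn hpos
  refine ⟨c⁻¹, inv_nonneg.2 hc.le, fun x => ?_⟩
  rcases eq_or_ne x 0 with rfl | hx
  · simp
  have hx' := norm_pos_iff.2 hx
  have := h (‖x‖⁻¹ • x) (by simp [norm_smul, hx'.ne'])
  rw [map_smul_eq_mul, norm_inv, norm_norm, le_inv_mul_iff₀ hx'] at this
  rw [le_inv_mul_iff₀ hc]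
  linarith

section InducedNorm

variable {n : ℕ} {N : Seminorm ℝ (Fin n → ℝ)}

theorem exists_seminorm_mulVec_le (hN : ∀ x, N x = 0 → x = 0) (A : Matrix (Fin n) (Fin n) ℝ) :
    ∃ c, 0 ≤ c ∧ ∀ x, N (A.mulVec x) ≤ c * N x := by
  obtain ⟨C, hC, h⟩ := N.exists_norm_le_mul hN
  obtain ⟨C', hC', h'⟩ := Seminorm.bound_of_continuous_normedSpace (N.comp A.mulVecLin)
    (N.comp A.mulVecLin).continuous_of_finiteDimensional
  refine ⟨C' * C, by positivity, fun x => (h' x).trans ?_⟩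
  rw [mul_assoc]
  exact mul_le_mul_of_nonneg_left (h x) hC'.le

theorem inducedNorm_nonneg (A : Matrix (Fin n) (Fin n) ℝ) : 0 ≤ inducedNorm N A :=
  Real.sInf_nonneg fun _ hc => hc.1

theorem inducedNorm_le {A : Matrix (Fin n) (Fin n) ℝ} {c : ℝ} (hc : 0 ≤ c)
    (h : ∀ x, N (A.mulVec x) ≤ c * N x) : inducedNorm N A ≤ c :=
  csInf_le ⟨0, fun _ hc => hc.1⟩ ⟨hc, h⟩

/-- For `N x > 0` the quotient `N (A x) / N x` is a lower bound of the set of admissible constants,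
which is nonempty. -/
theorem le_inducedNorm_mul (hN : ∀ x, N x = 0 → x = 0) (A : Matrix (Fin n) (Fin n) ℝ)
    (x : Fin n → ℝ) : N (A.mulVec x) ≤ inducedNorm N A * N x := by
  rcases (apply_nonneg N x).eq_or_lt with h | h
  · rw [hN x h.symm]; simp
  · rw [← div_le_iff₀ h]
    exact le_csInf (exists_seminorm_mulVec_le hN A) fun c hc => (div_le_iff₀ h).2 (hc.2 x)

theorem inducedNorm_zero : inducedNorm N 0 = 0 :=
  le_antisymm (inducedNorm_le le_rfl fun x => by simp) (inducedNorm_nonneg 0)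

theorem inducedNorm_add_le (hN : ∀ x, N x = 0 → x = 0) (A B : Matrix (Fin n) (Fin n) ℝ) :
    inducedNorm N (A + B) ≤ inducedNorm N A + inducedNorm N B := by
  refine inducedNorm_le (add_nonneg (inducedNorm_nonneg A) (inducedNorm_nonneg B)) fun x => ?_
  rw [Matrix.add_mulVec, add_mul]
  exact (map_add_le_add N _ _).trans
    (add_le_add (le_inducedNorm_mul hN A x) (le_inducedNorm_mul hN B x))

theorem inducedNorm_smul_le (hN : ∀ x, N x = 0 → x = 0) (r : ℝ) (A : Matrix (Fin n) (Fin n) ℝ) :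
    inducedNorm N (r • A) ≤ ‖r‖ * inducedNorm N A := by
  refine inducedNorm_le (mul_nonneg (norm_nonneg r) (inducedNorm_nonneg A)) fun x => ?_
  rw [Matrix.smul_mulVec, map_smul_eq_mul, mul_assoc]
  exact mul_le_mul_of_nonneg_left (le_inducedNorm_mul hN A x) (norm_nonneg r)

/-- The induced matrix norm as a seminorm. -/
noncomputable def inducedSeminorm (hN : ∀ x, N x = 0 → x = 0) :
    Seminorm ℝ (Fin n → Fin n → ℝ) :=
  Seminorm.ofSMulLE (fun A => inducedNorm N (Matrix.of A)) inducedNorm_zero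
    (fun A B => inducedNorm_add_le hN (Matrix.of A) (Matrix.of B))
    fun r A => inducedNorm_smul_le hN r (Matrix.of A)

theorem continuous_inducedNorm (hN : ∀ x, N x = 0 → x = 0) :
    Continuous (inducedNorm N) :=
  (inducedSeminorm hN).continuous_of_finiteDimensional

theorem inducedNorm_sub_comm (A B : Matrix (Fin n) (Fin n) ℝ) :
    inducedNorm N (A - B) = inducedNorm N (B - A) := by
  unfold inducedNorm
  simp_rw [Matrix.sub_mulVec, map_sub_rev N]

end InducedNorm

/-! ### The constants and the perturbation bounds. -/

section ErrorBounds

variable {n k : ℕ} {N : Seminorm ℝ (Fin n → ℝ)} {M : Fin k → Matrix (Fin n) (Fin n) ℝ}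

theorem isCompact_alphaValues (hN : ∀ x, N x = 0 → x = 0) (hM : RowWProperty (vlcpBlock M))
    (i : Fin k) : IsCompact (alphaValues N M i) := by
  refine (isCompact_diagTuples n k).image_of_continuousOn ?_
  refine (continuous_inducedNorm hN).comp_continuousOn ?_
  have hS : Continuous fun D : Fin (k + 1) → Matrix (Fin n) (Fin n) ℝ => vlcpSum M D := by
    unfold vlcpSum
    fun_prop
  refine ContinuousOn.mul (fun D hD => ?_) (by fun_prop)
  have hdet := (Matrix.isUnit_iff_isUnit_det _).1 (hM.isUnit_vlcpSum hD)
  refine ContinuousAt.continuousWithinAt ?_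
  -- The adjugate formula shows that inversion is continuous where the determinant is nonzero.
  simp_rw [Matrix.inv_def, Ring.inverse_eq_inv]
  exact (hS.matrix_det.continuousAt.inv₀ hdet.ne_zero).smul hS.matrix_adjugate.continuousAt

theorem isGreatest_alphaTilde (hN : ∀ x, N x = 0 → x = 0) (hM : RowWProperty (vlcpBlock M))
    (i : Fin k) : IsGreatest (alphaValues N M i) (alphaTilde N M i) :=
  (isCompact_alphaValues hN hM i).isGreatest_sSup ((diagTuples_nonempty n k).image _)

theorem alphaTilde_nonneg (i : Fin k) : 0 ≤ alphaTilde N M i := by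
  refine Real.sSup_nonneg ?_
  rintro _ ⟨D, -, rfl⟩
  exact inducedNorm_nonneg _

theorem tauTilde_nonneg {η : ℝ} (hη : η < 1) (i : Fin k) : 0 ≤ tauTilde N M η i :=
  mul_nonneg (one_div_nonneg.2 (sub_nonneg.2 hη.le)) (alphaTilde_nonneg i)

theorem tauTilde_zero (i : Fin k) : tauTilde N M 0 i = alphaTilde N M i := by
  simp [tauTilde]

theorem mem_vlcpNhd_zero : M ∈ vlcpNhd N M 0 := by
  simp [vlcpNhd, inducedNorm_zero]

theorem seminorm_le_sum_alphaTilde (hN : ∀ x, N x = 0 → x = 0) (hM : RowWProperty (vlcpBlock M))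
    {D : Fin (k + 1) → Matrix (Fin n) (Fin n) ℝ} (hD : D ∈ diagTuples n k) {z : Fin n → ℝ}
    {w : Fin k → Fin n → ℝ} (h : (vlcpSum M D).mulVec z = ∑ i, (D i.succ).mulVec (w i)) :
    N z ≤ ∑ i, alphaTilde N M i * N (w i) := by
  have hdet := (Matrix.isUnit_iff_isUnit_det _).1 (hM.isUnit_vlcpSum hD)
  have hz : z = ∑ i, ((vlcpSum M D)⁻¹ * D i.succ).mulVec (w i) := by
    simp_rw [← Matrix.mulVec_mulVec]
    rw [← Matrix.mulVec_sum, ← h, Matrix.mulVec_mulVec, Matrix.nonsing_inv_mul _ hdet,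
      Matrix.one_mulVec]
  conv_lhs => rw [hz]
  refine (Finset.le_sum_of_subadditive N (map_zero N).le (map_add_le_add N) _ _).trans ?_
  refine Finset.sum_le_sum fun i _ => (le_inducedNorm_mul hN _ _).trans ?_
  exact mul_le_mul_of_nonneg_right
    ((isGreatest_alphaTilde hN hM i).2 ⟨D, hD, rfl⟩) (apply_nonneg N _)

theorem seminorm_le_sum_tauTilde (hN : ∀ x, N x = 0 → x = 0) (hM : RowWProperty (vlcpBlock M))
    {η : ℝ} (hη : η < 1) {A : Fin k → Matrix (Fin n) (Fin n) ℝ} (hA : A ∈ vlcpNhd N M η)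
    {D : Fin (k + 1) → Matrix (Fin n) (Fin n) ℝ} (hD : D ∈ diagTuples n k) {z : Fin n → ℝ}
    {w : Fin k → Fin n → ℝ} (h : (vlcpSum A D).mulVec z = ∑ i, (D i.succ).mulVec (w i)) :
    N z ≤ ∑ i, tauTilde N M η i * N (w i) := by
  have h' : (vlcpSum M D).mulVec z =
      ∑ i, (D i.succ).mulVec (w i - (A i - M i).mulVec z) := by
    simp only [Matrix.mulVec_sub, Matrix.sub_mulVec, Finset.sum_sub_distrib]
    rw [← h, vlcpSum_mulVec, vlcpSum_mulVec]
    abel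
  have h₁ := seminorm_le_sum_alphaTilde hN hM hD h'
  have h₂ : ∑ i, alphaTilde N M i * N (w i - (A i - M i).mulVec z) ≤
      ∑ i, alphaTilde N M i * N (w i) + η * N z := by
    calc _ ≤ ∑ i, (alphaTilde N M i * N (w i) +
          alphaTilde N M i * inducedNorm N (A i - M i) * N z) := by
          refine Finset.sum_le_sum fun i _ => ?_
          rw [mul_assoc, ← mul_add]
          exact mul_le_mul_of_nonneg_left ((map_sub_le_add N _ _).trans
            (add_le_add le_rfl (le_inducedNorm_mul hN _ _))) (alphaTilde_nonneg i)
      _ ≤ _ := by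
          rw [Finset.sum_add_distrib, ← Finset.sum_mul]
          exact add_le_add le_rfl (mul_le_mul_of_nonneg_right hA (apply_nonneg N z))
  have hη' : 0 < 1 - η := sub_pos.2 hη
  simp_rw [tauTilde, mul_assoc]
  rw [← Finset.mul_sum, one_div, le_inv_mul_iff₀ hη']
  linarith

theorem rowWProperty_of_mem_vlcpNhd (hN : ∀ x, N x = 0 → x = 0) (hM : RowWProperty (vlcpBlock M))
    {η : ℝ} (hη : η < 1) {A : Fin k → Matrix (Fin n) (Fin n) ℝ} (hA : A ∈ vlcpNhd N M η) :
    RowWProperty (vlcpBlock A) := by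
  -- The perturbation bound with `w = 0` already excludes a nonzero kernel vector.
  refine rowWProperty_of_isUnit_vlcpSum fun D hD => isUnit_of_mulVec_eq_zero fun z hz => hN z ?_
  refine le_antisymm ?_ (apply_nonneg N z)
  simpa using seminorm_le_sum_tauTilde hN hM hη hA hD (w := 0) (by simpa using hz)

theorem seminorm_sub_le_of_isVLCPSolution (hN : ∀ x, N x = 0 → x = 0)
    (hM : RowWProperty (vlcpBlock M)) {η : ℝ} (hη : η < 1)
    {A B : Fin k → Matrix (Fin n) (Fin n) ℝ} (hA : A ∈ vlcpNhd N M η) {q p : Fin k → Fin n → ℝ}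
    {x y : Fin n → ℝ} (hx : IsVLCPSolution A q x) (hy : IsVLCPSolution B p y) :
    N (x - y) ≤ ∑ i, tauTilde N M η i * N ((B i - A i).mulVec y + (p i - q i)) := by
  replace hx := isEVLCPSolution_iff.1 hx
  replace hy := isEVLCPSolution_iff.1 hy
  obtain ⟨D, hD, h⟩ := exists_diagTuples_sum_mulVec_eq_zero (n := n) (k := k)
    (fun i => ((vlcpBlock A i).mulVec x + Matrix.vecCons 0 q i) -
      ((vlcpBlock B i).mulVec y + Matrix.vecCons 0 p i))
    (fun j => by
      obtain ⟨i, hi⟩ := (hx j).2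
      exact ⟨i, by rw [Pi.sub_apply]; linarith [(hy j).1 i]⟩)
    (fun j => by
      obtain ⟨i, hi⟩ := (hy j).2
      exact ⟨i, by rw [Pi.sub_apply]; linarith [(hx j).1 i]⟩)
  refine seminorm_le_sum_tauTilde hN hM hη hA hD ?_
  -- Block 0 is the identity with zero offset in both problems, so it contributes only `D 0 (x -
  -- y)`.
  rw [← sub_eq_zero, ← h, Fin.sum_univ_succ, vlcpSum_mulVec, add_sub_assoc,
    ← Finset.sum_sub_distrib]
  congr 1
  · simp [vlcpBlock]
  · refine Finset.sum_congr rfl fun i _ => ?_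
    rw [← Matrix.mulVec_sub]
    congr 1
    simp only [vlcpBlock, Matrix.cons_val_succ, Matrix.sub_mulVec, Matrix.mulVec_sub]
    abel

theorem isVLCPSolution_zero {B : Fin k → Matrix (Fin n) (Fin n) ℝ} {p : Fin k → Fin n → ℝ}
    (hp : ∀ i, 0 ≤ p i) : IsVLCPSolution B p 0 := by
  refine isEVLCPSolution_iff.2 fun j => ⟨fun i => ?_, 0, by simp⟩
  cases i using Fin.cases with
  | zero => simp
  | succ i => simpa using hp i j

/-- Compare `y` with the solution 0 for the data `p⁺`, and use `p⁺ - p = (-p)⁺`. -/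
theorem seminorm_le_of_isVLCPSolution (hN : ∀ x, N x = 0 → x = 0)
    (hM : RowWProperty (vlcpBlock M)) {η : ℝ} (hη : η < 1)
    {B : Fin k → Matrix (Fin n) (Fin n) ℝ} (hB : B ∈ vlcpNhd N M η) {p : Fin k → Fin n → ℝ}
    {y : Fin n → ℝ} (hy : IsVLCPSolution B p y) :
    N y ≤ ∑ i, tauTilde N M η i * N ((-p i)⁺) := by
  have h := seminorm_sub_le_of_isVLCPSolution hN hM hη hB hy
    (isVLCPSolution_zero (B := B) (p := fun i => (p i)⁺) fun i => posPart_nonneg _)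
  have hp : ∀ v : Fin n → ℝ, v⁺ - v = (-v)⁺ := fun v => by
    rw [posPart_neg, sub_eq_iff_eq_add, add_comm, ← sub_eq_iff_eq_add, posPart_sub_negPart]
  simpa [hp] using h

end ErrorBounds

theorem theorem3p3 {n k : ℕ} (N : Seminorm ℝ (Fin n → ℝ)) (hN : ∀ x, N x = 0 → x = 0)
    (M : Fin k → Matrix (Fin n) (Fin n) ℝ) (hM : RowWProperty (vlcpBlock M)) :
    -- the constants are well defined: the inverses exist and the maxima are attained
    (∀ D ∈ diagTuples n k, IsUnit (vlcpSum M D)) ∧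
    (∀ i, IsGreatest (alphaValues N M i) (alphaTilde N M i)) ∧
    -- (i)
    (∀ q q' : Fin k → Fin n → ℝ,
      (∃! x, IsVLCPSolution M q x) ∧ (∃! y, IsVLCPSolution M q' y) ∧
      ∀ x y, IsVLCPSolution M q x → IsVLCPSolution M q' y →
        N (x - y) ≤ ∑ i, alphaTilde N M i * N (q' i - q i)) ∧
    -- (ii)
    (∀ η : ℝ, η < 1 →
      (∀ A ∈ vlcpNhd N M η, RowWProperty (vlcpBlock A)) ∧
      ∀ A ∈ vlcpNhd N M η, ∀ B ∈ vlcpNhd N M η, ∀ q p : Fin k → Fin n → ℝ,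
        (∃! x, IsVLCPSolution A q x) ∧ (∃! y, IsVLCPSolution B p y) ∧
        ∀ x y, IsVLCPSolution A q x → IsVLCPSolution B p y →
          N (x - y) ≤
            (∑ i, tauTilde N M η i * inducedNorm N (A i - B i)) *
                (∑ i, tauTilde N M η i * N ((-p i)⁺)) +
              ∑ i, tauTilde N M η i * N (q i - p i)) := by
  have hex : ∀ {A : Fin k → Matrix (Fin n) (Fin n) ℝ}, RowWProperty (vlcpBlock A) →
      ∀ q, ∃! x, IsVLCPSolution A q x := fun hA q => hA.existsUnique_solution _
  refine ⟨fun D hD => hM.isUnit_vlcpSum hD, isGreatest_alphaTilde hN hM, fun q q' =>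
    ⟨hex hM q, hex hM q', fun x y hx hy => ?_⟩, fun η hη =>
    ⟨fun A hA => rowWProperty_of_mem_vlcpNhd hN hM hη hA, fun A hA B hB q p =>
      ⟨hex (rowWProperty_of_mem_vlcpNhd hN hM hη hA) q,
        hex (rowWProperty_of_mem_vlcpNhd hN hM hη hB) p, fun x y hx hy => ?_⟩⟩⟩
  -- Part (i) is the case `A = B = M`, `η = 0`.
  · simpa [tauTilde_zero] using
      seminorm_sub_le_of_isVLCPSolution hN hM zero_lt_one mem_vlcpNhd_zero hx hy
  · have hτ : ∀ i, 0 ≤ tauTilde N M η i := tauTilde_nonneg hη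
    calc N (x - y)
        ≤ ∑ i, tauTilde N M η i * N ((B i - A i).mulVec y + (p i - q i)) :=
          seminorm_sub_le_of_isVLCPSolution hN hM hη hA hx hy
      _ ≤ ∑ i, (tauTilde N M η i * inducedNorm N (A i - B i) * N y +
            tauTilde N M η i * N (q i - p i)) := by
          refine Finset.sum_le_sum fun i _ => ?_
          rw [mul_assoc, ← mul_add, inducedNorm_sub_comm, map_sub_rev N (q i)]
          exact mul_le_mul_of_nonneg_left ((map_add_le_add N _ _).trans
            (add_le_add (le_inducedNorm_mul hN _ _) le_rfl)) (hτ i)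
      _ ≤ _ := by
          rw [Finset.sum_add_distrib, ← Finset.sum_mul]
          refine add_le_add (mul_le_mul_of_nonneg_left
            (seminorm_le_of_isVLCPSolution hN hM hη hB hy) ?_) le_rfl
          exact Finset.sum_nonneg fun i _ => mul_nonneg (hτ i) (inducedNorm_nonneg _)
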